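/- A paratopological group is a group with a topology for which multiplication is jointly continuous; regular includes $T_1$. A paratopological group $G$ is simply $sm$-factorizable if for every co-zero set $U\subseteq G$ there is a continuous homomorphism $\pi$ of $G$ onto a separable metrizable paratopological group such that $\pi^{-1}(\pi(U))=U$; it is strongly submetrizable if it admits a coarser separable metrizable paratopological group topology. For a space $X$, $\upsilon X$ denotes the Hewitt–Nachbin realcompactification, i.e. the closure of the image of $X$ under $x\mapsto (f(x))_{f\in C(X,\mathbb R)}$ in $\mathbb R^{C(X,\mathbb R)}$, with the canonical map $X\to\upsilon X$. The $G_\delta$-closure of a subset $Y$ of a space $X$ is the set of all $x\in X$ such that every $G_\delta$-set in $X$ containing $x$ meets $Y$. Theorem. Let $G$ be a regular simply $sm$-factorizable paratopological group. Then the space $\upsilon G$ is realcompact, the canonical map $G\to\upsilon G$ is a homeomorphism of $G$ onto a dense $C$-embedded subspace of $\upsilon G$ (so we regard $G$ as a subspace of $\upsilon G$), and there is a unique group structure on $\upsilon G$ that makes it a paratopological group containing $G$ as a (dense) subgroup. With this structure, $\upsilon G$ is again simply $sm$-factorizable. Moreover, there are a family $(H_\alpha)_{\alpha\in A}$ of regular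 strongly submetrizable paratopological groups and a homomorphism $j\colon\upsilon G\to\prod_{\alpha\in A}H_\alpha$ that is a topological embedding, such that $G$ is mapped onto each $H_\alpha$ by the $\alpha$-th coordinate of $j$ and $j(\upsilon G)$ is the $G_\delta$-closure of $j(G)$ in $\prod_{\alpha\in A}H_\alpha$. -/

import Mathlib

open Topology

universe u

/-- The canonical map `x ↦ (f x)_f` of a space `X` to the product `ℝ ^ C(X, ℝ)`. -/
def realEval (X : Type u) [TopologicalSpace X] (x : X) : C(X, ℝ) → ℝ := fun f => f x

/-- The Hewitt–Nachbin realcompactification `υX`: the closure of the canonical image of `X`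
in `ℝ ^ C(X, ℝ)`, with the subspace topology. -/
def HewittNachbin (X : Type u) [TopologicalSpace X] : Type u :=
  {p : C(X, ℝ) → ℝ // p ∈ closure (Set.range (realEval X))}

instance HewittNachbin.instTopologicalSpace (X : Type u) [TopologicalSpace X] :
    TopologicalSpace (HewittNachbin X) :=
  inferInstanceAs (TopologicalSpace {p : C(X, ℝ) → ℝ // p ∈ closure (Set.range (realEval X))})

/-- The canonical map `X → υX`. -/
def HewittNachbin.unit (X : Type u) [TopologicalSpace X] (x : X) : HewittNachbin X :=
  ⟨realEval X x, subset_closure (Set.mem_range_self x)⟩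

/-- A space is realcompact if it is homeomorphic to a closed subspace of a power of `ℝ`. -/
def IsRealcompact (X : Type u) [TopologicalSpace X] : Prop :=
  ∃ (ι : Type u) (e : X → ι → ℝ), IsClosedEmbedding e

/-- `i : X → Y` exhibits `Y` as the realcompactification of `X`: `Y` is realcompact and `i` is a
homeomorphism of `X` onto a dense `C`-embedded subspace of `Y`. -/
structure IsRealcompactification {X Y : Type u} [TopologicalSpace X] [TopologicalSpace Y]
    (i : X → Y) : Prop where
  realcompact : IsRealcompact Y
  isEmbedding : IsEmbedding i
  denseRange : DenseRange i
  extend : ∀ f : C(X, ℝ), ∃ F : C(Y, ℝ), ∀ x, F (i x) = f x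

/-- A co-zero set. -/
def IsCozeroSet {X : Type u} [TopologicalSpace X] (U : Set X) : Prop :=
  ∃ f : C(X, ℝ), U = {x | f x ≠ 0}

/-- A paratopological group `G` is simply `sm`-factorizable if for each co-zero set `U` in `G` there
is a continuous homomorphism `π` of `G` onto a separable metrizable paratopological group `H`
with `π⁻¹(π(U)) = U`. (Such an `H` is an image of `G`, so it may be taken in the universe of `G`.) -/
def IsSimplySmFactorizable (G : Type u) [Group G] [TopologicalSpace G] : Prop :=
  ∀ U : Set G, IsCozeroSet U →
    ∃ (H : Type u) (_ : Group H) (_ : TopologicalSpace H) (π : G →* H),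
      ContinuousMul H ∧ TopologicalSpace.SeparableSpace H ∧ TopologicalSpace.MetrizableSpace H ∧
        Continuous π ∧ Function.Surjective π ∧ π ⁻¹' (π '' U) = U

/-- A paratopological group is strongly submetrizable if it admits a coarser separable metrizable
paratopological group topology. -/
def IsStronglySubmetrizable (G : Type u) [Group G] [t : TopologicalSpace G] : Prop :=
  ∃ s : TopologicalSpace G, t ≤ s ∧ @ContinuousMul G s _ ∧
    @TopologicalSpace.SeparableSpace G s ∧ @TopologicalSpace.MetrizableSpace G s

/-- The `G_δ`-closure of `Y` in `X`: the points all of whose `G_δ`-neighbourhoods (the `G_δ`-sets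
containing them) meet `Y`. -/
def gdeltaClosure {X : Type u} [TopologicalSpace X] (Y : Set X) : Set X :=
  {x | ∀ S : Set X, IsGδ S → x ∈ S → (S ∩ Y).Nonempty}

/-! Every continuous `f : G → ℝ` factors through a homomorphism `π f` onto a regular strongly
submetrizable group `H f`. Indeed, the sets `{f > q}`, `q` rational, yield countably many
homomorphisms to separable metrizable groups, and `f` is constant on the cosets of their common
kernel `N`. The quotient `G ⧸ N` need not be regular, but its semiregularization is, and continuous
maps to regular spaces survive the passage. Any countably many coordinates of a point of `υG` are
realized by a point of `G`. Since countably many functions separate the points of `H f`, each `π f`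
extends to `υG`. Together the extensions embed `υG` in the product of the `H f`, with image the
points agreeing with `G` on every countable set of coordinates. This image is a subgroup, whose
structure is carried back to `υG`; points of `H f` being `G_δ`, it is also the `G_δ`-closure of `G`.
-/

/-! ### Closures and complete regularity in paratopological groups -/

section ParatopologicalGroup

open scoped Pointwise

variable {G : Type*} [Group G] [TopologicalSpace G] [ContinuousMul G]

theorem closure_mul_subset_closure_mul (A V : Set G) : closure A * V ⊆ closure (A * V) := by
  rintro _ ⟨a, ha, v, hv, rfl⟩
  exact map_mem_closure (f := fun x => x * v) (continuous_mul_const v) ha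
    fun x hx => Set.mul_mem_mul hx hv

/-- The left side is a union of left translates of `V`, hence open; inversion need not be continuous
and is not used. -/
theorem closure_mul_subset_interior_closure_mul (A : Set G) {V : Set G} (hV : IsOpen V) :
    closure A * V ⊆ interior (closure (A * V)) :=
  interior_maximal (closure_mul_subset_closure_mul A V) hV.mul_left

theorem closure_subset_interior_closure_mul (A : Set G) {V : Set G} (hV : IsOpen V)
    (h1 : (1 : G) ∈ V) : closure A ⊆ interior (closure (A * V)) := fun x hx =>
  closure_mul_subset_interior_closure_mul A hV (by simpa using Set.mul_mem_mul hx h1)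

theorem interior_closure_mul_interior_closure_subset (A B : Set G) :
    interior (closure A) * interior (closure B) ⊆ interior (closure (A * B)) := by
  refine interior_maximal ?_ isOpen_interior.mul_left
  rintro _ ⟨a, ha, b, hb, rfl⟩
  exact map_mem_closure₂ continuous_mul (interior_subset ha) (interior_subset hb)
    fun x hx y hy => Set.mul_mem_mul hx hy

/-- A closed set `C` and an open set `U` in a paratopological group with `closure (C * V) ⊆ U` for
some neighbourhood `V` of `1` are separated by a continuous function. -/
theorem exists_continuous_zero_one_of_closure_mul_subset {C U V : Set G} (hC : IsClosed C)
    (hU : IsOpen U) (hV : V ∈ 𝓝 (1 : G)) (h : closure (C * V) ⊆ U) :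
    ∃ f : G → unitInterval, Continuous f ∧ (∀ x ∈ C, f x = 0) ∧ ∀ x ∉ U, f x = 1 := by
  let P : Set G → Set G → Prop := fun c u => ∃ V ∈ 𝓝 (1 : G), closure (c * V) ⊆ u
  have sub : ∀ {c u V : Set G}, V ∈ 𝓝 (1 : G) → closure (c * V) ⊆ u → c ⊆ u :=
    fun hV h x hx => h (subset_closure (by simpa using Set.mul_mem_mul hx (mem_of_mem_nhds hV)))
  let c : Urysohns.CU P :=
    { C := C
      U := U
      P_C_U := ⟨V, hV, h⟩
      closed_C := hC
      open_U := hU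
      subset := sub hV h
      hP := by
        rintro c u - ⟨V, hV, hcu⟩ - -
        -- With `W * W ⊆ V` and `W' * W' ⊆ W`, the interpolating set is `interior (closure (c *
        -- W))`.
        obtain ⟨W, hWo, hW1, hWV⟩ := exists_open_nhds_one_mul_subset hV
        obtain ⟨W', hWo', hW1', hWW'⟩ := exists_open_nhds_one_mul_subset (hWo.mem_nhds hW1)
        have hcl : closure (interior (closure (c * W))) ⊆ closure (c * W) :=
          closure_minimal interior_subset isClosed_closure
        have hv : closure (closure (interior (closure (c * W))) * W) ⊆ u := by
          refine subset_trans (closure_minimal ?_ isClosed_closure) hcu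
          calc closure (interior (closure (c * W))) * W
              ⊆ closure (c * W) * W := Set.mul_subset_mul_right hcl
            _ ⊆ closure (c * W * W) := closure_mul_subset_closure_mul _ _
            _ ⊆ closure (c * V) := closure_mono (by
                rw [mul_assoc]; exact Set.mul_subset_mul_left hWV)
        have hcv : closure (c * W') ⊆ interior (closure (c * W)) := by
          refine (closure_subset_interior_closure_mul _ hWo' hW1').trans
            (interior_mono (closure_mono ?_))
          rw [mul_assoc]
          exact Set.mul_subset_mul_left hWW'
        exact ⟨interior (closure (c * W)), isOpen_interior, sub (hWo'.mem_nhds hW1') hcv,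
          sub (hWo.mem_nhds hW1) hv, ⟨W', hWo'.mem_nhds hW1', hcv⟩,
          ⟨W, hWo.mem_nhds hW1, hv⟩⟩ }
  refine ⟨fun x => ⟨c.lim x, c.lim_mem_Icc x⟩, c.continuous_lim.subtype_mk _, fun x hx => ?_,
    fun x hx => ?_⟩
  · exact Subtype.ext (c.lim_of_mem_C x hx)
  · exact Subtype.ext (c.lim_of_notMem_U x hx)

/-- Every regular paratopological group is completely regular. -/
theorem t35Space_of_continuousMul [T3Space G] : T35Space G where
  completely_regular := by
    intro x K hK hx
    obtain ⟨C, hCx, hC, hCK⟩ := exists_mem_nhds_isClosed_subset (hK.isOpen_compl.mem_nhds hx)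
    have hV : (fun v => x * v) ⁻¹' C ∈ 𝓝 (1 : G) :=
      (continuous_const_mul x).continuousAt.preimage_mem_nhds (by simpa using hCx)
    obtain ⟨f, hf, h0, h1⟩ := exists_continuous_zero_one_of_closure_mul_subset
      (isClosed_singleton (x := x)) hK.isOpen_compl hV
      ((closure_minimal (by rintro _ ⟨_, rfl, v, hv, rfl⟩; exact hv) hC).trans hCK)
    exact ⟨f, hf, h0 x rfl, fun y hy => h1 y (by simpa using hy)⟩

end ParatopologicalGroup

/-! ### Semiregularization -/

/-- A copy of the space `X`, carrying the topology generated by the regular open sets of `X`. -/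
def Semiregularization (X : Type u) : Type u := X

namespace Semiregularization

open scoped Pointwise

instance instGroup (X : Type u) [h : Group X] : Group (Semiregularization X) := h

section Space

variable {X : Type u} [TopologicalSpace X]

theorem interior_closure_interior_closure (A : Set X) :
    interior (closure (interior (closure A))) ⊆ interior (closure A) :=
  interior_mono (closure_minimal interior_subset isClosed_closure)

instance instTopologicalSpace : TopologicalSpace (Semiregularization X) where
  IsOpen W := ∀ x : X, x ∈ (show Set X from W) →
    ∃ U : Set X, IsOpen U ∧ x ∈ U ∧ interior (closure U) ⊆ (show Set X from W)
  isOpen_univ x _ := ⟨Set.univ, isOpen_univ, trivial, Set.subset_univ _⟩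
  isOpen_inter s t hs ht x hx := by
    obtain ⟨U, hU, hxU, hUs⟩ := hs x hx.1
    obtain ⟨V, hV, hxV, hVt⟩ := ht x hx.2
    exact ⟨U ∩ V, hU.inter hV, ⟨hxU, hxV⟩, Set.subset_inter
      ((interior_mono (closure_mono Set.inter_subset_left)).trans hUs)
      ((interior_mono (closure_mono Set.inter_subset_right)).trans hVt)⟩
  isOpen_sUnion S hS x hx := by
    obtain ⟨s, hs, hxs⟩ := hx
    obtain ⟨U, hU, hxU, hUs⟩ := hS s hs x hxs
    exact ⟨U, hU, hxU, hUs.trans (Set.subset_sUnion_of_mem hs)⟩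

/-- The identity map from `X` to its semiregularization. -/
def mk (x : X) : Semiregularization X := x

/-- The identity map from the semiregularization of `X` to `X`. -/
def val (x : Semiregularization X) : X := x

theorem isOpen_iff {W : Set (Semiregularization X)} : IsOpen W ↔
    ∀ x, mk x ∈ W → ∃ U : Set X, IsOpen U ∧ x ∈ U ∧ interior (closure U) ⊆ mk ⁻¹' W :=
  Iff.rfl

theorem continuous_mk : Continuous (mk : X → Semiregularization X) := by
  refine ⟨fun W hW => isOpen_iff_mem_nhds.2 fun x hx => ?_⟩
  obtain ⟨U, hU, hxU, hUW⟩ := isOpen_iff.1 hW x hx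
  exact Filter.mem_of_superset (hU.mem_nhds hxU) ((interior_maximal subset_closure hU).trans hUW)

theorem isOpen_interior_closure (A : Set X) :
    IsOpen (val ⁻¹' interior (closure A)) :=
  isOpen_iff.2 fun _ hx =>
    ⟨interior (closure A), isOpen_interior, hx, interior_closure_interior_closure A⟩

theorem isClosed_closure {A : Set X} (hA : IsOpen A) :
    IsClosed (val ⁻¹' closure A) := by
  rw [← isOpen_compl_iff, isOpen_iff]
  refine fun x hx => ⟨(closure A)ᶜ, _root_.isClosed_closure.isOpen_compl, hx, ?_⟩
  rw [closure_compl, interior_compl]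
  exact fun y hy hyA => hy (closure_mono (interior_maximal subset_closure hA) hyA)

/-- For a closed neighbourhood `C` of `f x` inside `V`, the preimage of `interior C` has its closure
in the preimage of `C`, hence in that of `V`. -/
theorem continuous_of_regular {Y : Type*} [TopologicalSpace Y] [RegularSpace Y]
    {f : Semiregularization X → Y} (hf : Continuous (f ∘ mk)) : Continuous f := by
  refine ⟨fun V hV => isOpen_iff.2 fun x hx => ?_⟩
  obtain ⟨C, hCx, hC, hCV⟩ := exists_mem_nhds_isClosed_subset (hV.mem_nhds hx)
  refine ⟨f ∘ mk ⁻¹' interior C, isOpen_interior.preimage hf, mem_interior_iff_mem_nhds.2 hCx, ?_⟩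
  refine interior_subset.trans ((closure_minimal (t := f ∘ mk ⁻¹' C)
    (Set.preimage_mono interior_subset) (hC.preimage hf)).trans (Set.preimage_mono hCV))

end Space

variable {G : Type u} [Group G] [TopologicalSpace G] [ContinuousMul G]

/-- The identity map from `G` to its semiregularization, as a homomorphism. -/
def mkHom (G : Type u) [Group G] : G →* Semiregularization G := MonoidHom.id G

instance instContinuousMul : ContinuousMul (Semiregularization G) where
  continuous_mul := by
    refine continuous_def.2 fun W hW => isOpen_prod_iff.2 fun x y hxy => ?_
    obtain ⟨U, hU, hxU, hUW⟩ := isOpen_iff.1 hW (val x * val y) hxy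
    obtain ⟨A, B, hA, hB, hxA, hyB, hAB⟩ := isOpen_prod_iff.1
      (hU.preimage (continuous_mul (M := G))) (val x) (val y) hxU
    refine ⟨_, _, isOpen_interior_closure A, isOpen_interior_closure B,
      interior_maximal subset_closure hA hxA, interior_maximal subset_closure hB hyB, ?_⟩
    rintro ⟨a, b⟩ ⟨ha, hb⟩
    refine hUW (interior_mono (closure_mono ?_)
      (interior_closure_mul_interior_closure_subset A B (Set.mul_mem_mul ha hb)))
    rintro _ ⟨a, ha, b, hb, rfl⟩
    exact hAB (Set.mk_mem_prod ha hb)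

instance instRegularSpace : RegularSpace (Semiregularization G) := by
  refine RegularSpace.of_exists_mem_nhds_isClosed_subset fun x s hs => ?_
  obtain ⟨W, hWs, hW, hxW⟩ := mem_nhds_iff.1 hs
  obtain ⟨U, hU, hxU, hUW⟩ := isOpen_iff.1 hW (val x) hxW
  obtain ⟨A, V, hA, hV, hxA, h1V, hAV⟩ := isOpen_prod_iff.1
    (hU.preimage (continuous_mul (M := G))) (val x) 1 (by simpa using! hxU)
  refine ⟨_, mem_nhds_iff.2 ⟨_, Set.preimage_mono (interior_subset (s := closure A)),
    isOpen_interior_closure A, interior_maximal subset_closure hA hxA⟩, isClosed_closure hA, ?_⟩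
  refine ((closure_subset_interior_closure_mul A hV h1V).trans
    (interior_mono (closure_mono ?_))).trans (hUW.trans hWs)
  rintro _ ⟨a, ha, b, hb, rfl⟩
  exact hAV (Set.mk_mem_prod ha hb)

end Semiregularization

/-! ### The Hewitt–Nachbin realcompactification -/

theorem T35Space.isInducing_realEval {X : Type u} [TopologicalSpace X] [T35Space X] :
    IsInducing (realEval X) := by
  refine isInducing_iff_nhds.2 fun x => le_antisymm
    (Continuous.tendsto (continuous_pi fun f : C(X, ℝ) => f.continuous) x).le_comap fun s hs => ?_
  obtain ⟨f, hf, h0, h1⟩ := CompletelyRegularSpace.completely_regular x (interior s)ᶜ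
    isOpen_interior.isClosed_compl (by simpa using mem_interior_iff_mem_nhds.2 hs)
  let F : C(X, ℝ) := ⟨fun y => f y, by fun_prop⟩
  refine ⟨{p | p F < 1}, (isOpen_lt (continuous_apply F) continuous_const).mem_nhds ?_,
    fun y hy => ?_⟩
  · simp [realEval, F, h0]
  · by_contra hys
    have := h1 (fun h => hys (interior_subset h) : y ∈ (interior s)ᶜ)
    have hy' : (f y : ℝ) < 1 := hy
    simp [this] at hy'

theorem T35Space.isEmbedding_realEval {X : Type u} [TopologicalSpace X] [T35Space X] :
    IsEmbedding (realEval X) := isInducing_realEval.isEmbedding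

namespace HewittNachbin

variable {X : Type u} [TopologicalSpace X]

theorem isInducing_val : IsInducing fun p : HewittNachbin X => p.1 := ⟨rfl⟩

theorem continuous_eval (f : C(X, ℝ)) : Continuous fun p : HewittNachbin X => p.1 f :=
  (continuous_apply f).comp continuous_subtype_val

theorem continuous_unit : Continuous (unit X) :=
  (continuous_pi fun f : C(X, ℝ) => f.continuous).subtype_mk _

theorem denseRange_unit : DenseRange (unit X) := by
  intro p
  rw [isInducing_val.closure_eq_preimage_closure_image, Set.mem_preimage, ← Set.range_comp]
  exact p.2

instance instT2Space : T2Space (HewittNachbin X) :=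
  inferInstanceAs (T2Space {p : C(X, ℝ) → ℝ // p ∈ closure (Set.range (realEval X))})

theorem isRealcompactification_unit [T35Space X] : IsRealcompactification (unit X) where
  realcompact := ⟨C(X, ℝ), Subtype.val, isClosed_closure.isClosedEmbedding_subtypeVal⟩
  isEmbedding := .of_comp continuous_unit continuous_subtype_val T35Space.isEmbedding_realEval
  denseRange := denseRange_unit
  extend f := ⟨⟨fun p => p.1 f, continuous_eval f⟩, fun _ => rfl⟩

/-- Countably many values of a point of `υX` are those of a point of `X`. -/
theorem exists_forall_eq {ι : Type*} [Countable ι] (p : HewittNachbin X) (f : ι → C(X, ℝ)) :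
    ∃ x : X, ∀ i, f i x = p.1 (f i) := by
  have closed : ∀ {S : Set (C(X, ℝ) → ℝ)}, IsClosed S → (∀ x, realEval X x ∈ S) → p.1 ∈ S :=
    fun hS h => closure_minimal (Set.range_subset_iff.2 h) hS p.2
  obtain _ | _ := isEmpty_or_nonempty ι
  · obtain ⟨_, x, rfl⟩ := closure_nonempty_iff.1 ⟨p.1, p.2⟩
    exact ⟨x, isEmptyElim⟩
  obtain ⟨e, he⟩ := exists_surjective_nat ι
  -- The sum `h` of this series vanishes at `x` exactly when `x` realizes all the prescribed values.
  let t : ℕ → (C(X, ℝ) → ℝ) → ℝ := fun n q => (1 / 2) ^ n * min 1 |q (f (e n)) - p.1 (f (e n))|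
  have ht : ∀ n, Continuous (t n) := fun n => by fun_prop
  have ht0 : ∀ n q, 0 ≤ t n q := fun n q => by positivity
  have ht1 : ∀ n q, t n q ≤ (1 / 2) ^ n := fun n q =>
    mul_le_of_le_one_right (by positivity) (min_le_left _ _)
  have hts : ∀ q, Summable fun n => t n q := fun q =>
    .of_nonneg_of_le (ht0 · q) (ht1 · q) summable_geometric_two
  let h : C(X, ℝ) := ⟨fun x => ∑' n, t n (realEval X x), continuous_tsum
    (fun n => (ht n).comp (continuous_pi fun f : C(X, ℝ) => f.continuous)) summable_geometric_two
    fun n x => by rw [Real.norm_of_nonneg (ht0 _ _)]; exact ht1 _ _⟩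
  -- The coordinate `p.1 h` is not a priori the sum of the series at `p`. But bounding `h` by a
  -- partial sum plus a geometric tail is a closed condition, and the partial sums vanish at `p`.
  have hle : ∀ N : ℕ, p.1 h ≤ (1 / 2) ^ N * 2 := fun N => by
    have : p.1 ∈ {q : C(X, ℝ) → ℝ | q h ≤ ∑ n ∈ Finset.range N, t n q + (1 / 2) ^ N * 2} := by
      refine closed (isClosed_le (by fun_prop) (by fun_prop)) fun x => ?_
      have h1 : h x = _ := ((hts (realEval X x)).sum_add_tsum_nat_add N).symm
      rw [Set.mem_ofPred_eq, show realEval X x h = h x from rfl, h1]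
      gcongr
      have hgeo : (1 / 2 : ℝ) ^ N * 2 = ∑' n : ℕ, (1 / 2) ^ N * (1 / 2) ^ n := by
        rw [tsum_mul_left, tsum_geometric_two]
      rw [hgeo]
      refine Summable.tsum_le_tsum (fun n => ?_) ((summable_nat_add_iff N).2 (hts _))
        (summable_geometric_two.mul_left _)
      rw [← pow_add, add_comm N n]
      exact ht1 _ _
    simpa [t] using this
  have hp : p.1 h ≤ 0 := ge_of_tendsto' (by
    simpa using (tendsto_pow_atTop_nhds_zero_of_lt_one (r := (1 / 2 : ℝ)) (by norm_num)
      (by norm_num)).mul_const 2) hle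
  by_contra! hne
  have hpos : ∀ x, 0 < h x := fun x => by
    obtain ⟨i, hi⟩ := hne x
    obtain ⟨n, rfl⟩ := he i
    refine (hts _).tsum_pos (ht0 · _) n (mul_pos (by positivity) (lt_min one_pos ?_))
    exact abs_pos.2 (sub_ne_zero.2 hi)
  -- If no `x` works, `h` is invertible in `C(X, ℝ)`, and `p.1 h * p.1 k = 1` contradicts `p.1 h ≤
  -- 0`.
  let k : C(X, ℝ) := ⟨fun x => (h x)⁻¹, h.continuous.inv₀ fun x => (hpos x).ne'⟩
  have hk : 0 ≤ p.1 k := closed (S := {q | 0 ≤ q k}) (isClosed_le (by fun_prop) (by fun_prop))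
    fun x => (inv_pos.2 (hpos x)).le
  have hhk : p.1 h * p.1 k = 1 := closed (S := {q | q h * q k = 1})
    (isClosed_eq (by fun_prop) (by fun_prop)) fun x => mul_inv_cancel₀ (hpos x).ne'
  linarith [mul_nonpos_of_nonpos_of_nonneg hp hk]

end HewittNachbin

/-! ### Factorization through strongly submetrizable groups -/

theorem exists_seq_continuous_separating (X : Type*) [Nonempty X] [TopologicalSpace X]
    [TopologicalSpace.SeparableSpace X] [TopologicalSpace.MetrizableSpace X] :
    ∃ φ : ℕ → X → ℝ, (∀ n, Continuous (φ n)) ∧ ∀ x y, (∀ n, φ n x = φ n y) → x = y := by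
  let := TopologicalSpace.metrizableSpaceMetric X
  refine ⟨fun n x => dist x (TopologicalSpace.denseSeq X n), fun n => by fun_prop,
    fun x y h => ?_⟩
  have : (fun z => dist x z) = fun z => dist y z :=
    (TopologicalSpace.denseRange_denseSeq X).equalizer (by fun_prop) (by fun_prop)
      (funext fun n => h n)
  exact dist_eq_zero.1 ((congrFun this y).trans (dist_self y))

theorem IsStronglySubmetrizable.exists_seq_continuous_separating {H : Type u} [Group H]
    [t : TopologicalSpace H] (h : IsStronglySubmetrizable H) :
    ∃ φ : ℕ → C(H, ℝ), ∀ x y, (∀ n, φ n x = φ n y) → x = y := by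
  obtain ⟨s, hs, -, h1, h2⟩ := h
  obtain ⟨φ, hφc, hφ⟩ := @_root_.exists_seq_continuous_separating H _ s h1 h2
  exact ⟨fun n => @ContinuousMap.mk _ _ t _ (φ n) (continuous_le_dom hs (hφc n)), hφ⟩

/-- Each continuous real-valued function on a simply `sm`-factorizable paratopological group factors
through a continuous homomorphism onto a regular strongly submetrizable paratopological group. -/
theorem IsSimplySmFactorizable.exists_factorization {G : Type u} [Group G] [TopologicalSpace G]
    [ContinuousMul G] (hG : IsSimplySmFactorizable G) (f : C(G, ℝ)) :
    ∃ (H : Type u) (_ : Group H) (_ : TopologicalSpace H) (π : G →* H) (f' : C(H, ℝ)),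
      ContinuousMul H ∧ T3Space H ∧ IsStronglySubmetrizable H ∧ Continuous π ∧
        Function.Surjective π ∧ ∀ x, f' (π x) = f x := by
  have hcoz : ∀ q : ℚ, IsCozeroSet {x | (q : ℝ) < f x} := fun q => by
    refine ⟨⟨fun x => max (f x - q) 0, by fun_prop⟩, Set.ext fun x => ?_⟩
    simp
  choose K iG iT ρ hmul hsep hmet hcont hsurj hρ using fun q => hG _ (hcoz q)
  have hsc : ∀ q, SecondCountableTopology (K q) := fun q => by
    let := TopologicalSpace.metrizableSpaceMetric (K q)
    exact UniformSpace.secondCountable_of_separable _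
  let Φ : G →* ∀ q, K q := MonoidHom.pi ρ
  have hΦ : Continuous Φ := continuous_pi hcont
  have hf : ∀ x y, Φ x = Φ y → f x = f y := by
    have key : ∀ x y, Φ x = Φ y → ∀ q : ℚ, (q : ℝ) < f x → (q : ℝ) < f y := fun x y h q hq => by
      have : y ∈ ρ q ⁻¹' (ρ q '' {x | (q : ℝ) < f x}) := ⟨x, hq, congrFun h q⟩
      rwa [hρ q] at this
    have le : ∀ x y, Φ x = Φ y → f x ≤ f y := fun x y h => by
      by_contra! hlt
      obtain ⟨q, h1, h2⟩ := exists_rat_btwn hlt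
      exact lt_asymm h1 (key x y h q h2)
    exact fun x y h => le_antisymm (le x y h) (le y x h.symm)
  let N := Φ.ker
  have : ContinuousMul (G ⧸ N) := ⟨by
    rw [← (QuotientGroup.isOpenQuotientMap_mk.prodMap
      QuotientGroup.isOpenQuotientMap_mk).continuous_comp_iff]
    exact QuotientGroup.continuous_mk.comp continuous_mul⟩
  let Ψ : Semiregularization (G ⧸ N) →* ∀ q, K q := QuotientGroup.kerLift Φ
  have hΨinj : Function.Injective Ψ := QuotientGroup.kerLift_injective Φ
  have hΨ : Continuous Ψ := Semiregularization.continuous_of_regular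
    (continuous_quot_lift _ hΦ)
  let f' : Semiregularization (G ⧸ N) → ℝ := Quotient.lift f fun x y h => hf x y (by
    rw [← QuotientGroup.kerLift_mk Φ x, ← QuotientGroup.kerLift_mk Φ y]
    exact congrArg _ (Quotient.sound h))
  have hf' : Continuous f' := Semiregularization.continuous_of_regular
    (continuous_quot_lift _ f.continuous)
  refine ⟨Semiregularization (G ⧸ N), inferInstance, inferInstance,
    (Semiregularization.mkHom _).comp (QuotientGroup.mk' N), ⟨f', hf'⟩, inferInstance, ?_, ?_,
    ?_, QuotientGroup.mk'_surjective N, fun x => rfl⟩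
  · have : T2Space (Semiregularization (G ⧸ N)) := .of_injective_continuous hΨinj hΨ
    exact {}
  -- The coarser topology comes from the injection into a countable product of second countable
  -- metrizable groups.
  · refine ⟨TopologicalSpace.induced Ψ inferInstance, hΨ.le_induced,
      continuousMul_induced Ψ, ?_, ?_⟩
    · let := TopologicalSpace.induced Ψ inferInstance
      have := TopologicalSpace.secondCountableTopology_induced (Semiregularization (G ⧸ N)) _ Ψ
      exact TopologicalSpace.SecondCountableTopology.to_separableSpace
    · let t := TopologicalSpace.induced Ψ inferInstance
      exact @IsEmbedding.metrizableSpace _ _ t _ _ Ψ (@IsEmbedding.mk _ _ t _ _ ⟨rfl⟩ hΨinj)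
  · have : Continuous (Semiregularization.mk ∘ (QuotientGroup.mk : G → G ⧸ N)) :=
      Semiregularization.continuous_mk.comp QuotientGroup.continuous_mk
    exact this

theorem IsStronglySubmetrizable.isGδ_singleton {H : Type u} [Group H] [TopologicalSpace H]
    (h : IsStronglySubmetrizable H) (x : H) : IsGδ {x} := by
  obtain ⟨φ, hφ⟩ := h.exists_seq_continuous_separating
  have : {x} = ⋂ n, φ n ⁻¹' {φ n x} := by
    ext y
    simpa using ⟨fun h n => h ▸ rfl, fun h => hφ _ _ h⟩
  rw [this]
  refine .iInter fun n => (IsGδ.singleton (φ n x)).preimage (φ n).continuous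

/-! ### Embedding in a product and `G_δ`-closures -/

/-- In a product of spaces with `G_δ` points, the `G_δ`-closure of `Y` consists of the points that
agree with points of `Y` on all countable sets of coordinates. -/
theorem mem_gdeltaClosure_pi {A : Type u} {H : A → Type u} [∀ a, TopologicalSpace (H a)]
    (hH : ∀ a (x : H a), IsGδ {x}) {Y : Set (∀ a, H a)} {y : ∀ a, H a} :
    y ∈ gdeltaClosure Y ↔ ∀ C : Set A, C.Countable → ∃ z ∈ Y, ∀ a ∈ C, z a = y a := by
  constructor
  · intro hy C hC
    obtain ⟨z, hz, hzY⟩ := hy (⋂ a ∈ C, (fun z => z a) ⁻¹' {y a})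
      (.biInter hC fun a _ => (hH a (y a)).preimage (continuous_apply a)) (by simp)
    exact ⟨z, hzY, by simpa using hz⟩
  · rintro h S ⟨T, hTo, hT, rfl⟩ hy
    choose! I u hu hI using fun U hU => isOpen_pi_iff.1 (hTo U hU) y (hy U hU)
    obtain ⟨z, hzY, hz⟩ := h (⋃ U ∈ T, I U) (hT.biUnion fun U _ => (I U).countable_toSet)
    refine ⟨z, fun U hU => hI U hU fun a ha => ?_, hzY⟩
    rw [hz a (Set.mem_biUnion hU ha)]
    exact (hu U hU a ha).2

/-- The subgroup of the points of a product of groups that agree on every countable set of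
coordinates with a point of the image of `G`. -/
def countableAgreement {G A : Type*} {H : A → Type*} [Group G] [∀ a, Group (H a)]
    (π : ∀ a, G →* H a) : Subgroup (∀ a, H a) where
  carrier := {y | ∀ C : Set A, C.Countable → ∃ g, ∀ a ∈ C, π a g = y a}
  one_mem' C _ := ⟨1, fun a _ => map_one (π a)⟩
  mul_mem' {x y} hx hy C hC := by
    obtain ⟨g, hg⟩ := hx C hC
    obtain ⟨h, hh⟩ := hy C hC
    exact ⟨g * h, fun a ha => by simp [hg a ha, hh a ha]⟩
  inv_mem' {x} hx C hC := by
    obtain ⟨g, hg⟩ := hx C hC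
    exact ⟨g⁻¹, fun a ha => by simp [hg a ha]⟩

/-- Let `π f : G → H f`, `f ∈ C(G, ℝ)`, be continuous homomorphisms to completely regular groups
whose points are separated by countably many continuous functions, such that each `f` factors
through `π f`. Then `υG` is embedded in the product of the groups `H f`, and its image consists of
the points agreeing with points of `G` on countable sets of coordinates. -/
theorem HewittNachbin.exists_isEmbedding_pi {G : Type u} [Group G] [TopologicalSpace G]
    {H : C(G, ℝ) → Type u} [∀ f, Group (H f)] [∀ f, TopologicalSpace (H f)] [∀ f, T35Space (H f)]
    (hH : ∀ f, ∃ φ : ℕ → C(H f, ℝ), ∀ x y, (∀ n, φ n x = φ n y) → x = y)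
    (π : ∀ f, G →* H f) (hπ : ∀ f, Continuous (π f))
    (F : ∀ f, C(H f, ℝ)) (hF : ∀ f x, F f (π f x) = f x) :
    ∃ j : HewittNachbin G → ∀ f, H f, IsEmbedding j ∧ (∀ x f, j (unit G x) f = π f x) ∧
      (∀ p f, F f (j p f) = p.1 f) ∧ Set.range j = countableAgreement π := by
  choose φ hφ using hH
  let pull : ∀ f, C(H f, ℝ) → C(G, ℝ) := fun f ψ => ψ.comp ⟨π f, hπ f⟩
  have hex : ∀ (p : HewittNachbin G) f, ∃ y : H f, ∀ n, φ f n y = p.1 (pull f (φ f n)) :=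
    fun p f => by
      obtain ⟨g, hg⟩ := p.exists_forall_eq fun n => pull f (φ f n)
      exact ⟨π f g, hg⟩
  choose j hj using hex
  have agree : ∀ (p : HewittNachbin G) f g, (∀ n, pull f (φ f n) g = p.1 (pull f (φ f n))) →
      j p f = π f g := fun p f g hg => hφ f _ _ fun n => (hj p f n).trans (hg n).symm
  have key : ∀ p f (ψ : C(H f, ℝ)), ψ (j p f) = p.1 (pull f ψ) := fun p f ψ => by
    -- One `g` realizes both the separating sequence, which forces `j p f = π f g`, and the extra
    -- function `ψ`.
    obtain ⟨g, hg⟩ := p.exists_forall_eq fun o : Option ℕ => o.elim (pull f ψ)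
      fun n => pull f (φ f n)
    rw [agree p f g fun n => hg (some n)]
    exact hg none
  have hFj : ∀ p f, F f (j p f) = p.1 f := fun p f => by
    rw [key]
    exact congrArg p.1 (ContinuousMap.ext (hF f))
  have hcont : Continuous j := continuous_pi fun f =>
    T35Space.isInducing_realEval.continuous_iff.2 <| continuous_pi fun ψ => by
      have : (fun p => realEval (H f) (j p f) ψ) = fun p => p.1 (pull f ψ) :=
        funext fun p => key p f ψ
      exact this ▸ continuous_eval _
  have hval : Continuous fun (y : ∀ f, H f) f => F f (y f) := by fun_prop
  have hcomp : (fun (y : ∀ f, H f) f => F f (y f)) ∘ j = Subtype.val :=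
    funext fun p => funext fun f => hFj p f
  refine ⟨j, .of_comp hcont hval (hcomp ▸ IsEmbedding.subtypeVal),
    fun x f => agree _ _ _ fun _ => rfl, hFj, Set.Subset.antisymm ?_ fun y hy => ?_⟩
  · rintro _ ⟨p, rfl⟩ C hC
    have := hC.to_subtype
    obtain ⟨g, hg⟩ := p.exists_forall_eq fun i : C × ℕ => pull i.1 (φ i.1 i.2)
    exact ⟨g, fun f hf => (agree p f g fun n => hg (⟨f, hf⟩, n)).symm⟩
  · have hmem : (fun f => F f (y f)) ∈ closure (Set.range (realEval G)) := by
      refine mem_closure_iff.2 fun U hU hyU => ?_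
      obtain ⟨I, u, hu, hI⟩ := isOpen_pi_iff.1 hU _ hyU
      obtain ⟨g, hg⟩ := hy I I.countable_toSet
      refine ⟨_, hI fun f hf => ?_, g, rfl⟩
      rw [realEval, ← hF f g, hg f hf]
      exact (hu f hf).2
    refine ⟨⟨_, hmem⟩, funext fun f => ?_⟩
    -- The coordinate `f` gives `y f = π f g`; the others make `g` realize the values that define
    -- `j` at `f`.
    obtain ⟨g, hg⟩ := hy (insert f (Set.range fun n => pull f (φ f n)))
      ((Set.countable_range _).insert f)
    rw [← hg f (Set.mem_insert _ _)]
    refine agree _ _ _ fun n => ?_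
    rw [← hF (pull f (φ f n)), hg _ (Set.mem_insert_of_mem _ ⟨n, rfl⟩)]

/-! ### Uniqueness of the group structure and the main theorem -/

theorem HewittNachbin.group_ext {G : Type u} [Mul G] [TopologicalSpace G]
    {g₁ g₂ : Group (HewittNachbin G)}
    (h₁ : @ContinuousMul (HewittNachbin G) _ g₁.toMul)
    (h₂ : @ContinuousMul (HewittNachbin G) _ g₂.toMul)
    (hu₁ : ∀ x y : G, unit G (x * y) = g₁.mul (unit G x) (unit G y))
    (hu₂ : ∀ x y : G, unit G (x * y) = g₂.mul (unit G x) (unit G y)) : g₁ = g₂ := by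
  refine Group.ext (funext fun x => funext fun y => ?_)
  have := (denseRange_unit (X := G)).prodMap (denseRange_unit (X := G))
  exact congrFun (this.equalizer (@continuous_mul _ _ g₁.toMul h₁)
    (@continuous_mul _ _ g₂.toMul h₂)
    (funext fun z => (hu₁ z.1 z.2).symm.trans (hu₂ z.1 z.2))) (x, y)

theorem theorem4p3 (G : Type u) [Group G] [TopologicalSpace G] [ContinuousMul G] [T3Space G]
    (hG : IsSimplySmFactorizable G) :
    IsRealcompactification (HewittNachbin.unit G) ∧
    ∃ grp : Group (HewittNachbin G),
      -- a paratopological group containing `G` as a (dense) subgroup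
      ContinuousMul (HewittNachbin G) ∧
      (∀ x y : G, HewittNachbin.unit G (x * y) = HewittNachbin.unit G x * HewittNachbin.unit G y) ∧
      -- the structure is the only one with these properties
      (∀ grp' : Group (HewittNachbin G),
        @ContinuousMul (HewittNachbin G) _ grp'.toMul →
        (∀ x y : G, HewittNachbin.unit G (x * y) =
          grp'.mul (HewittNachbin.unit G x) (HewittNachbin.unit G y)) →
        grp' = grp) ∧
      IsSimplySmFactorizable (HewittNachbin G) ∧
      -- realization as a `G_δ`-closure in a product of strongly submetrizable groups
      ∃ (A : Type u) (H : A → Type u) (_ : ∀ a, Group (H a)) (_ : ∀ a, TopologicalSpace (H a))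
        (j : HewittNachbin G →* ∀ a, H a),
        (∀ a, ContinuousMul (H a) ∧ T3Space (H a) ∧ IsStronglySubmetrizable (H a)) ∧
        (∀ a, Function.Surjective fun x : G => j (HewittNachbin.unit G x) a) ∧
        IsEmbedding j ∧
        Set.range j = gdeltaClosure (Set.range fun x : G => j (HewittNachbin.unit G x)) := by
  have : T35Space G := t35Space_of_continuousMul
  refine ⟨HewittNachbin.isRealcompactification_unit, ?_⟩
  choose H iG iT π F hmul hT3 hsub hcont hsurj hfac using hG.exists_factorization
  have (f : C(G, ℝ)) : T35Space (H f) := t35Space_of_continuousMul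
  obtain ⟨j₀, hj₀, hunit, hF, hrange⟩ := HewittNachbin.exists_isEmbedding_pi
    (fun f => (hsub f).exists_seq_continuous_separating) π hcont F hfac
  let e : HewittNachbin G ≃ countableAgreement π :=
    (Equiv.ofInjective j₀ hj₀.injective).trans (Equiv.setCongr hrange)
  let grp : Group (HewittNachbin G) := e.group
  let j : HewittNachbin G →* ∀ f, H f := (countableAgreement π).subtype.comp e.mulEquiv.toMonoidHom
  have hj : (j : HewittNachbin G → ∀ f, H f) = j₀ := rfl
  have hjemb : IsEmbedding j := hj₀
  have hjunit : ∀ x f, j (HewittNachbin.unit G x) f = π f x := hunit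
  have hjF : ∀ p f, F f (j p f) = p.1 f := hF
  have hjsurj : ∀ f, Function.Surjective fun x : G => j (HewittNachbin.unit G x) f := fun f => by
    simpa only [hjunit] using hsurj f
  have hjmul : ContinuousMul (HewittNachbin G) := hjemb.isInducing.continuousMul j
  have hmulunit : ∀ x y : G, HewittNachbin.unit G (x * y) =
      HewittNachbin.unit G x * HewittNachbin.unit G y := fun x y =>
    hjemb.injective (funext fun f => by simp [hjunit])
  refine ⟨grp, hjmul, hmulunit, fun grp' h' hu' => HewittNachbin.group_ext h' hjmul hu' hmulunit,
    ?_, C(G, ℝ), H, iG, iT, j, fun f => ⟨hmul f, hT3 f, hsub f⟩, hjsurj, hjemb, ?_⟩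
  · rintro _ ⟨Φ, rfl⟩
    let f : C(G, ℝ) := Φ.comp ⟨_, HewittNachbin.continuous_unit⟩
    have hΦ : ∀ p, Φ p = F f (j p f) := fun p => by
      refine congrFun (HewittNachbin.denseRange_unit.equalizer Φ.continuous
        (HewittNachbin.continuous_eval f) rfl) p |>.trans (hjF p f).symm
    have hjf : Continuous fun p => j p f := (continuous_apply f).comp hjemb.continuous
    -- `F f` need not be continuous for `s`: saturation only needs `Φ p` to depend on `j p f` alone.
    obtain ⟨s, hs, hs1, hs2, hs3⟩ := hsub f
    refine ⟨H f, iG f, s, (Pi.evalMonoidHom H f).comp j, hs1, hs2, hs3,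
      continuous_le_rng hs hjf, fun y => ?_, ?_⟩
    · obtain ⟨x, hx⟩ := hjsurj f y
      exact ⟨_, hx⟩
    · refine Set.Subset.antisymm ?_ (Set.subset_preimage_image _ _)
      rintro p ⟨q, hq, hqp⟩
      have hqp' : j q f = j p f := hqp
      simp only [Set.mem_ofPred_eq, hΦ] at hq ⊢
      rwa [← hqp']
  · ext y
    rw [mem_gdeltaClosure_pi fun f x => (hsub f).isGδ_singleton x, hj, hrange]
    refine forall₂_congr fun C _ => ?_
    simp only [Set.exists_range_iff, ← hj, hjunit]
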